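/- Let $l\ge 1$, let $0<a_1<\dots<a_l$ be real numbers, and let $w_1,\dots,w_l,v_1,\dots,v_l$ be polynomials with complex coefficients such that $w_l(n)\ne 0$ for every $n\in\mathbb N_0$ and $v_i(n)\neq 0$ for every $n\in\mathbb N_0$ and $i=1,\dots,l$. Suppose that $$m(n)=\frac{w_1(n)}{v_1(n)}a_1^n+\dots+\frac{w_l(n)}{v_l(n)}a_l^n,\qquad n\in\mathbb N_0,$$ is a sequence of positive real numbers. Then $m$ preserves summability, i.e. for every complex Banach space $\mathbb E$, every real $k>0$, every $d\in\mathbb R$ and every formal power series $\hat u=\sum_{n\ge0}u_nt^n\in\mathbb E[[t]]$, the series $\hat u$ is $k$-summable in the direction $d$ if and only if $\mathcal B_m\hat u:=\sum_{n\ge0}\frac{u_n}{m(n)}t^n$ is $k$-summable in the direction $d$. Here $\hat u$ is called $k$-summable in the direction $d$ if there are $\alpha,r>0$ such that $\sum_{n\ge 0}\frac{u_n}{\Gamma(1+n/k)}t^n$ converges in a neighbourhood of $0$ and its sum extends to a holomorphic function $f:\hat S_d(\alpha,r)\to\mathbb E$ on the disc-sector $$\hat S_d(\alpha,r)=\{\rho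 e^{i\varphi}:\rho>0,\ |\varphi-d|<\alpha/2\}\cup\{t\in\mathbb{C}:|t|<r\}$$ with the property that for all $\tilde\alpha\in(0,\alpha)$ and $\tilde r\in(0,r)$ there are constants $A,B>0$ with $\|f(t)\|_{\mathbb E}<Ae^{B|t|^k}$ for every $t\in\hat S_d(\tilde\alpha,\tilde r)$. -/

import Mathlib

open scoped Topology

universe u

/-- The unbounded sector `S_d(α)` in direction `d` with opening `α`. -/
def sector (d α : ℝ) : Set ℂ :=
  {z | ∃ ρ φ : ℝ, 0 < ρ ∧ φ ∈ Set.Ioo (d - α / 2) (d + α / 2) ∧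
    z = (ρ : ℂ) * Complex.exp ((φ : ℂ) * Complex.I)}

/-- The disc-sector `S_d(α) ∪ D_r`. For `α, r > 0` it is an open subset of `ℂ`. -/
def discSector (d α r : ℝ) : Set ℂ :=
  sector d α ∪ Metric.ball 0 r

/-- The `m`-Borel operator `∑ aₙ tⁿ ↦ ∑ (aₙ / m(n)) tⁿ`. A formal power series with coefficients
in `E` is represented by its sequence of coefficients. -/
noncomputable def mBorel {E : Type*} [NormedAddCommGroup E] [NormedSpace ℂ E]
    (m : ℕ → ℝ) (u : ℕ → E) : ℕ → E :=
  fun n => ((m n : ℂ)⁻¹) • u n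

/-- The sequence `Γ_{1/k} = (Γ(1 + n/k))_{n ≥ 0}`. -/
noncomputable def gammaSeq (k : ℝ) : ℕ → ℝ :=
  fun n => Real.Gamma (1 + (n : ℝ) / k)

/-- `f` is holomorphic on the (open) disc-sector `S_d(α) ∪ D_r` and of exponential growth of order
at most `k` there: on every smaller disc-sector it is bounded by some `A * exp (B * |t| ^ k)`. -/
def HasExpGrowth {E : Type*} [NormedAddCommGroup E] [NormedSpace ℂ E]
    (k d α r : ℝ) (f : ℂ → E) : Prop :=
  DifferentiableOn ℂ f (discSector d α r) ∧
    ∀ α' ∈ Set.Ioo 0 α, ∀ r' ∈ Set.Ioo 0 r, ∃ A B : ℝ, 0 < A ∧ 0 < B ∧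
      ∀ t ∈ discSector d α' r', ‖f t‖ < A * Real.exp (B * ‖t‖ ^ k)

/-- The formal power series `∑ uₙ tⁿ` converges near `0` and its sum there is `f`. -/
def IsExpansionAtZero {E : Type*} [NormedAddCommGroup E] [NormedSpace ℂ E]
    (u : ℕ → E) (f : ℂ → E) : Prop :=
  ∀ᶠ t in 𝓝 (0 : ℂ), HasSum (fun n : ℕ => t ^ n • u n) (f t)

/-- `∑ uₙ tⁿ` is `k`-summable in the direction `d`: its Borel transform `∑ uₙ tⁿ / Γ(1 + n/k)`
converges near `0` and its sum extends to a holomorphic function of exponential growth of order at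
most `k` on some disc-sector in the direction `d`. -/
def IsSummableInDirection {E : Type*} [NormedAddCommGroup E] [NormedSpace ℂ E]
    (k d : ℝ) (u : ℕ → E) : Prop :=
  ∃ α r : ℝ, 0 < α ∧ 0 < r ∧ ∃ f : ℂ → E,
    HasExpGrowth k d α r f ∧ IsExpansionAtZero (mBorel (gammaSeq k) u) f

/-- `m` preserves summability: for every complex Banach space `E`, every `k > 0`, every direction
`d` and every formal power series `u` over `E`, the series `u` is `k`-summable in the direction `d`
if and only if its `m`-Borel transform is. -/
def PreservesSummability (m : ℕ → ℝ) : Prop :=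
  ∀ (E : Type u) [NormedAddCommGroup E] [NormedSpace ℂ E] [CompleteSpace E]
    (k : ℝ), 0 < k → ∀ (d : ℝ) (u : ℕ → E),
      IsSummableInDirection k d u ↔ IsSummableInDirection k d (mBorel m u)

/-!
Write the sequence as `m(n) = (w_l(n) / v_l(n)) * a_lⁿ * (1 + ε(n))`, where
`ε(n) = ∑_{i<l} (w_i v_l / (v_i w_l))(n) * (a_i / a_l)ⁿ` decays exponentially. The Borel transform
of order `k` acts on coefficients, hence commutes with multiplication of the coefficients by a
sequence. It is therefore enough to show that multiplying by each of these factors, and by its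
inverse, preserves the class of power series whose sum continues to a function of exponential
growth of order `k` on a disc-sector (`PreservesExtendability`).

The factors have concrete meanings for the sum `f(t)` of the series. The multiplier `aⁿ` is the
rescaling `f(a t)`; the multiplier `n` is the Euler operator `t d/dt`, controlled by Cauchy's
estimate; and `1 / (n + μ)` with `Re μ > 1` is the integral `∫₀¹ x^(μ - 1) f(x t) dx`. For a
polynomial `P` without zeros in `ℕ`, the multiplier `1 / P(n)` reduces to such integrals after
removing finitely many coefficients (`PreservesExtendability.of_shift`).

The inverse of `1 + ε` is the Neumann series `∑ (-ε)ʲ` (`PreservesExtendability.inv_one_add`).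
As `|ε(n)| ≤ ϑ^(n+1)` with `ϑ < 1` after a shift, the power series of the `j`-th term converges in a
disc of radius of order `ϑ^(-j)`, so at a point `t` all but `J = O(log ‖t‖)` terms are summable
directly. The first `J` terms involve `O(J)` derivatives of `f`. The notion of
`IsTameMultiplier` records the cost of one application of `ε` in terms of the loss of domain; with
a loss of `1 / J` in each step the first `J` terms cost a factor `(C J)^(p J)`, which is smaller
than `exp (‖t‖ ^ k)` because `J` is only logarithmic in `‖t‖`.
-/

/-! ### Geometry of disc-sectors -/

theorem discSector_mono {d α α' r r' : ℝ} (hα : α' ≤ α) (hr : r' ≤ r) :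
    discSector d α' r' ⊆ discSector d α r := by
  rintro z (⟨ρ, φ, hρ, hφ, rfl⟩ | hz)
  · exact Or.inl ⟨ρ, φ, hρ, ⟨by linarith [hφ.1], by linarith [hφ.2]⟩, rfl⟩
  · exact Or.inr (Metric.ball_subset_ball hr hz)

theorem zero_mem_discSector {d α r : ℝ} (hr : 0 < r) : (0 : ℂ) ∈ discSector d α r :=
  Or.inr (Metric.mem_ball_self hr)

theorem real_smul_mem_discSector {d α r : ℝ} (hr : 0 < r) {s : ℝ} (hs₀ : 0 ≤ s) (hs₁ : s ≤ 1)
    {z : ℂ} (hz : z ∈ discSector d α r) : (s : ℂ) * z ∈ discSector d α r := by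
  rcases hs₀.eq_or_lt with rfl | hs
  · simpa using zero_mem_discSector hr
  rcases hz with ⟨ρ, φ, hρ, hφ, rfl⟩ | hz
  · exact Or.inl ⟨s * ρ, φ, by positivity, hφ, by push_cast; ring⟩
  · refine Or.inr ?_
    rw [mem_ball_zero_iff] at hz ⊢
    rw [norm_mul, Complex.norm_real, Real.norm_of_nonneg hs₀]
    nlinarith [norm_nonneg z]

/-- A point close to a point `z` of a sector, relative to `‖z‖`, lies in a slightly larger
sector: the argument of `w / z = 1 + (w - z) / z` is at most `3 / 2 * ‖w - z‖ / ‖z‖`. -/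
theorem mem_sector_of_norm_sub_le {d α α' κ : ℝ} (hκ : κ ≤ 1 / 2) (hα : 3 * κ < α - α')
    {z w : ℂ} (hz : z ∈ sector d α') (hw : ‖w - z‖ ≤ κ * ‖z‖) : w ∈ sector d α := by
  obtain ⟨ρ, φ, hρ, hφ, rfl⟩ := hz
  set z : ℂ := (ρ : ℂ) * Complex.exp (φ * Complex.I) with hzdef
  have hzn : ‖z‖ = ρ := by
    rw [hzdef, norm_mul, Complex.norm_exp_ofReal_mul_I, Complex.norm_real,
      Real.norm_of_nonneg hρ.le, mul_one]
  have hz0 : z ≠ 0 := norm_pos_iff.mp (hzn ▸ hρ)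
  set q : ℂ := (w - z) / z with hq
  have hqn : ‖q‖ ≤ κ := by
    rw [hq, norm_div, div_le_iff₀ (norm_pos_iff.mpr hz0)]
    exact hw
  have hlog := Complex.norm_log_one_add_half_le_self (hqn.trans hκ)
  have hne : 1 + q ≠ 0 := by
    intro h
    have : q = -1 := by linear_combination h
    rw [this, norm_neg, norm_one] at hqn
    linarith
  have him : |(Complex.log (1 + q)).im| ≤ 3 / 2 * κ :=
    (Complex.abs_im_le_norm _).trans (hlog.trans (by linarith))
  rw [abs_le] at him
  refine ⟨ρ * Real.exp (Complex.log (1 + q)).re, φ + (Complex.log (1 + q)).im, by positivity,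
    ⟨by linarith [hφ.1], by linarith [hφ.2]⟩, ?_⟩
  have hwq : w = z * (1 + q) := by rw [hq]; field_simp; ring
  rw [hwq]
  nth_rewrite 1 [← Complex.exp_log hne]
  nth_rewrite 1 [← Complex.re_add_im (Complex.log (1 + q))]
  rw [hzdef, Complex.exp_add]
  push_cast
  rw [add_mul, Complex.exp_add]
  ring

theorem isOpen_discSector (d α r : ℝ) : IsOpen (discSector d α r) := by
  refine IsOpen.union ?_ Metric.isOpen_ball
  rw [Metric.isOpen_iff]
  rintro z ⟨ρ, φ, hρ, hφ, rfl⟩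
  set z : ℂ := (ρ : ℂ) * Complex.exp (φ * Complex.I) with hzdef
  have hzn : ‖z‖ = ρ := by
    rw [hzdef, norm_mul, Complex.norm_exp_ofReal_mul_I, Complex.norm_real,
      Real.norm_of_nonneg hρ.le, mul_one]
  -- `z` already lies in a sector with a smaller opening `α'`.
  obtain ⟨α', h₁, h₂⟩ : ∃ α', 2 * |φ - d| < α' ∧ α' < α := by
    refine exists_between ?_
    have : |φ - d| < α / 2 := abs_lt.mpr ⟨by linarith [hφ.1], by linarith [hφ.2]⟩
    linarith
  have h₃ := abs_lt.mp (show |φ - d| < α' / 2 by linarith)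
  have hz' : z ∈ sector d α' := ⟨ρ, φ, hρ, ⟨by linarith, by linarith⟩, rfl⟩
  have hκ : 0 < min (1 / 2) ((α - α') / 4) := lt_min (by norm_num) (by linarith)
  refine ⟨min (1 / 2) ((α - α') / 4) * ρ, by positivity, fun w hw => ?_⟩
  refine mem_sector_of_norm_sub_le (κ := min (1 / 2) ((α - α') / 4)) (min_le_left _ _) ?_ hz' ?_
  · exact (mul_le_mul_of_nonneg_left (min_le_right _ _) (by norm_num)).trans_lt (by linarith)
  · rw [hzn, ← dist_eq_norm]
    exact (Metric.mem_ball.mp hw).le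

/-- Around each point `z` of a scaled disc-sector there is a disc of radius proportional to
`‖z‖` and to the increase of the scale that is contained in the larger disc-sector. -/
theorem closedBall_subset_discSector {d α r κ s s' : ℝ} (hr : 0 < r)
    (hκ : 0 < κ) (hκ₂ : κ ≤ 1 / 4) (hκα : 4 * κ ≤ α) (hs' : 1 ≤ s') (hs : s' < s) (hs₂ : s ≤ 2)
    {z : ℂ} (hz : z ∈ discSector d (s' * α) (s' * r)) :
    Metric.closedBall z (κ * (s - s') * ‖z‖) ⊆ discSector d (s * α) (s * r) := by
  intro w hw
  rw [Metric.mem_closedBall, dist_eq_norm] at hw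
  rcases hz with hz | hz
  · refine Or.inl (mem_sector_of_norm_sub_le ?_ ?_ hz hw)
    · nlinarith
    · nlinarith
  · refine Or.inr ?_
    rw [mem_ball_zero_iff] at hz ⊢
    have h := norm_add_le (w - z) z
    rw [sub_add_cancel] at h
    have h₁ : κ * (s - s') * ‖z‖ ≤ κ * (s - s') * (s' * r) :=
      mul_le_mul_of_nonneg_left hz.le (mul_nonneg hκ.le (by linarith))
    have h₂ : κ * (s - s') * (s' * r) ≤ (s - s') * r := by
      have : κ * s' ≤ 1 := by nlinarith
      have h₃ : 0 ≤ (s - s') * r := mul_nonneg (by linarith) hr.le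
      nlinarith
    nlinarith

theorem norm_real_smul_lt {R b : ℝ} (hb : 0 < b) {t : ℂ} (ht : ‖t‖ < R / b) :
    ‖(b : ℂ) * t‖ < R := by
  rw [norm_mul, Complex.norm_real, Real.norm_of_nonneg hb.le, mul_comm]
  exact (lt_div_iff₀ hb).mp ht

/-! ### Vector-valued power series -/

section

variable {E : Type u} [NormedAddCommGroup E] [NormedSpace ℂ E]

/-- The power series `∑ uₙ tⁿ` converges on the disc `‖t‖ < R` and its sum there is `f`. -/
def ExpandsOn (u : ℕ → E) (f : ℂ → E) (R : ℝ) : Prop :=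
  ∀ t : ℂ, ‖t‖ < R → HasSum (fun n : ℕ => t ^ n • u n) (f t)

theorem isExpansionAtZero_iff {u : ℕ → E} {f : ℂ → E} :
    IsExpansionAtZero u f ↔ ∃ R, 0 < R ∧ ExpandsOn u f R := by
  unfold IsExpansionAtZero ExpandsOn
  rw [Metric.eventually_nhds_iff]
  simp only [dist_zero_right, gt_iff_lt]

/-- The coefficients of a power series decay geometrically at any rate below its radius. -/
theorem ExpandsOn.exists_norm_coeff_le {u : ℕ → E} {f : ℂ → E} {R ρ : ℝ} (h : ExpandsOn u f R)
    (hρ : 0 < ρ) (hρR : ρ < R) : ∃ K : ℝ, 0 ≤ K ∧ ∀ n, ‖u n‖ ≤ K * (ρ⁻¹) ^ n := by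
  have hs := (h (ρ : ℂ) (by rwa [Complex.norm_real, Real.norm_of_nonneg hρ.le])).summable
  obtain ⟨K, hK⟩ := hs.tendsto_atTop_zero.norm.bddAbove_range
  refine ⟨K, (norm_nonneg _).trans (hK ⟨0, rfl⟩), fun n => ?_⟩
  have := hK ⟨n, rfl⟩
  simp only [norm_smul, norm_pow, Complex.norm_real, Real.norm_of_nonneg hρ.le] at this
  rw [inv_pow, ← div_eq_mul_inv, le_div_iff₀ (by positivity)]
  linarith

theorem ExpandsOn.summable_norm {u : ℕ → E} {f : ℂ → E} {R : ℝ} (h : ExpandsOn u f R) {t : ℂ}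
    (ht : ‖t‖ < R) : Summable fun n : ℕ => ‖t‖ ^ n * ‖u n‖ := by
  obtain ⟨ρ, hρt, hρR⟩ := exists_between ht
  have h0 : 0 < ρ := (norm_nonneg t).trans_lt hρt
  obtain ⟨K, hK0, hK⟩ := h.exists_norm_coeff_le h0 hρR
  refine Summable.of_nonneg_of_le (fun n => by positivity) (fun n => ?_)
    ((summable_geometric_of_lt_one (by positivity) ((div_lt_one h0).mpr hρt)).mul_left K)
  calc ‖t‖ ^ n * ‖u n‖ ≤ ‖t‖ ^ n * (K * (ρ⁻¹) ^ n) := by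
        gcongr
        exact hK n
    _ = K * (‖t‖ / ρ) ^ n := by rw [inv_pow, div_pow]; ring

theorem ExpandsOn.hasSum_deriv [CompleteSpace E] {u : ℕ → E} {f : ℂ → E}
    {R : ℝ} (h : ExpandsOn u f R) {z : ℂ} (hz : ‖z‖ < R) :
    HasSum (fun n : ℕ => (n * z ^ (n - 1)) • u n) (deriv f z) := by
  obtain ⟨ρ', hρz, hρR'⟩ := exists_between hz
  obtain ⟨ρ, hρ', hρR⟩ := exists_between hρR'
  have h0' : 0 < ρ' := (norm_nonneg z).trans_lt hρz
  have h0 : 0 < ρ := h0'.trans hρ'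
  obtain ⟨K, hK0, hK⟩ := h.exists_norm_coeff_le h0 hρR
  have hq : ρ' / ρ < 1 := (div_lt_one h0).mpr hρ'
  have hsum : Summable fun n : ℕ => K * (ρ' / ρ) ^ n :=
    (summable_geometric_of_lt_one (by positivity) hq).mul_left K
  have key := Complex.hasSum_deriv_of_summable_norm (F := fun (n : ℕ) (w : ℂ) => w ^ n • u n)
    (U := Metric.ball 0 ρ') (z := z) hsum (fun n => by fun_prop) Metric.isOpen_ball ?_
    (by simpa using hρz)
  · convert! key using 1
    · funext n
      have := ((hasDerivAt_pow n z).smul_const (u n)).deriv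
      rw [this]
    · refine Filter.EventuallyEq.deriv_eq ?_
      filter_upwards [Metric.isOpen_ball.mem_nhds (show z ∈ Metric.ball 0 R by simpa using hz)]
        with w hw
      exact (h w (by simpa using hw)).tsum_eq.symm
  · intro n w hw
    rw [norm_smul, norm_pow, div_pow, mul_comm]
    have hw' : ‖w‖ ≤ ρ' := (mem_ball_zero_iff.mp hw).le
    calc ‖u n‖ * ‖w‖ ^ n ≤ (K * (ρ⁻¹) ^ n) * ρ' ^ n := by
          gcongr
          exact hK n
      _ = K * (ρ' ^ n / ρ ^ n) := by rw [inv_pow]; ring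

end

/-! ### Tame multipliers -/

section

variable {E : Type u} [NormedAddCommGroup E] [NormedSpace ℂ E]

/-- `c` acts as a coefficient multiplier with gain `b` on power series over `E` whose sum extends
holomorphically to `S₂`, where `Sₛ` is the disc-sector of opening `s * α` and radius `s * r`:
if `f` extends `∑ uₙ tⁿ`, then `∑ cₙ uₙ tⁿ` has a holomorphic extension `g` to the same disc-sector,
the disc of convergence grows by the factor `1 / b`, and a bound of `f` by a nondecreasing function
of `‖t‖` on `Sₛ` passes to `g` on the smaller `Sₛ'` at a cost that is polynomial in
`1 / (s - s')`. The constants `C` and `p` depend neither on the series nor on its bound, so that the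
estimate can be iterated. -/
def IsTameMultiplier (E : Type u) [NormedAddCommGroup E] [NormedSpace ℂ E]
    (d α r b : ℝ) (c : ℕ → ℂ) : Prop :=
  ∃ C : ℝ, 1 ≤ C ∧ ∃ p : ℕ, ∀ (f : ℂ → E) (u : ℕ → E) (R : ℝ),
    DifferentiableOn ℂ f (discSector d (2 * α) (2 * r)) → ExpandsOn u f R →
    ∃ g : ℂ → E, DifferentiableOn ℂ g (discSector d (2 * α) (2 * r)) ∧
      ExpandsOn (fun n => c n • u n) g (R / b) ∧
      ∀ (G : ℝ → ℝ) (s s' : ℝ), MonotoneOn G (Set.Ici 0) → (∀ x, 0 ≤ x → 0 ≤ G x) →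
        1 ≤ s' → s' < s → s ≤ 2 →
        (∀ t ∈ discSector d (s * α) (s * r), ‖f t‖ ≤ G ‖t‖) →
        ∀ t ∈ discSector d (s' * α) (s' * r), ‖g t‖ ≤ (C / (s - s')) ^ p * G ‖t‖

namespace IsTameMultiplier

variable {d α r b b' : ℝ} {c c' : ℕ → ℂ}

theorem gain_mono (h : IsTameMultiplier E d α r b c) (hb : 0 < b) (hbb : b ≤ b') :
    IsTameMultiplier E d α r b' c := by
  obtain ⟨C, hC, p, h⟩ := h
  refine ⟨C, hC, p, fun f u R hf hu => ?_⟩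
  obtain ⟨g, hg, hgu, hG⟩ := h f u R hf hu
  refine ⟨g, hg, fun t ht => ?_, hG⟩
  rcases le_or_gt R 0 with hR | hR
  · exact absurd (ht.trans_le (div_nonpos_of_nonpos_of_nonneg hR (hb.le.trans hbb)))
      (norm_nonneg t).not_gt
  · exact hgu t (ht.trans_le (div_le_div_of_nonneg_left hR.le hb hbb))

theorem mul (h : IsTameMultiplier E d α r b c)
    (h' : IsTameMultiplier E d α r b' c') :
    IsTameMultiplier E d α r (b * b') (fun n => c n * c' n) := by
  obtain ⟨C, hC, p, h⟩ := h
  obtain ⟨C', hC', p', h'⟩ := h'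
  refine ⟨2 * C * C', by nlinarith, p + p', fun f u R hf hu => ?_⟩
  obtain ⟨g', hg', hgu', hG'⟩ := h' f u R hf hu
  obtain ⟨g, hg, hgu, hG⟩ := h g' _ _ hg' hgu'
  refine ⟨g, hg, ?_, fun G s s' hm hp hs' hs hs₂ hfG t ht => ?_⟩
  · simpa [smul_smul, div_div, mul_comm] using hgu
  · have hδ : 0 < s - s' := sub_pos.mpr hs
    -- Half of the loss of domain is spent on each of the two multipliers.
    have h₁ := hG' G s ((s + s') / 2) hm hp (by linarith) (by linarith) hs₂ hfG
    have h₂ := hG (fun x => (C' / (s - (s + s') / 2)) ^ p' * G x) ((s + s') / 2) s'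
      (fun x hx y hy hxy => mul_le_mul_of_nonneg_left (hm hx hy hxy)
        (pow_nonneg (div_nonneg (by linarith) (by linarith)) _))
      (fun x hx => mul_nonneg (pow_nonneg (div_nonneg (by linarith) (by linarith)) _) (hp x hx))
      hs' (by linarith) (by linarith) h₁ t ht
    refine h₂.trans ?_
    have e₁ : s - (s + s') / 2 = (s - s') / 2 := by ring
    have e₂ : (s + s') / 2 - s' = (s - s') / 2 := by ring
    rw [e₁, e₂, ← mul_assoc, pow_add, div_div_eq_mul_div, div_div_eq_mul_div]
    have hp0 := hp ‖t‖ (norm_nonneg t)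
    have h₃ : C * 2 ≤ 2 * C * C' := by nlinarith
    have h₄ : C' * 2 ≤ 2 * C * C' := by nlinarith
    gcongr

theorem add (h : IsTameMultiplier E d α r b c) (h' : IsTameMultiplier E d α r b c') :
    IsTameMultiplier E d α r b (fun n => c n + c' n) := by
  obtain ⟨C, hC, p, h⟩ := h
  obtain ⟨C', hC', p', h'⟩ := h'
  refine ⟨C + C', by linarith, p + p' + 1, fun f u R hf hu => ?_⟩
  obtain ⟨g, hg, hgu, hG⟩ := h f u R hf hu
  obtain ⟨g', hg', hgu', hG'⟩ := h' f u R hf hu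
  refine ⟨fun t => g t + g' t, hg.add hg', fun t ht => ?_,
    fun G s s' hm hp hs' hs hs₂ hfG t ht => ?_⟩
  · simpa only [add_smul, smul_add] using (hgu t ht).add (hgu' t ht)
  · have hδ : 0 < s - s' := sub_pos.mpr hs
    have h₁ : 1 ≤ C / (s - s') := (one_le_div hδ).mpr (by linarith)
    have h₁' : 1 ≤ C' / (s - s') := (one_le_div hδ).mpr (by linarith)
    have hp0 := hp ‖t‖ (norm_nonneg t)
    calc ‖g t + g' t‖ ≤ ‖g t‖ + ‖g' t‖ := norm_add_le _ _
      _ ≤ (C / (s - s')) ^ p * G ‖t‖ + (C' / (s - s')) ^ p' * G ‖t‖ :=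
          add_le_add (hG G s s' hm hp hs' hs hs₂ hfG t ht) (hG' G s s' hm hp hs' hs hs₂ hfG t ht)
      _ = ((C / (s - s')) ^ p + (C' / (s - s')) ^ p') * G ‖t‖ := by ring
      _ ≤ ((C / (s - s')) ^ (p + p' + 1) + (C' / (s - s')) ^ (p + p' + 1)) * G ‖t‖ := by
          have e₁ := pow_le_pow_right₀ h₁ (show p ≤ p + p' + 1 by omega)
          have e₂ := pow_le_pow_right₀ h₁' (show p' ≤ p + p' + 1 by omega)
          gcongr
      _ ≤ ((C + C') / (s - s')) ^ (p + p' + 1) * G ‖t‖ := by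
          rw [add_div]
          gcongr
          exact pow_add_pow_le (by linarith) (by linarith) (by omega)

theorem const_mul_pow (hα : 0 < α) (hr : 0 < r) (hb : 0 < b) (hb₁ : b ≤ 1) (A : ℂ) :
    IsTameMultiplier E d α r b (fun n => A * (b : ℂ) ^ n) := by
  have hmaps : ∀ s : ℝ, 0 < s → ∀ t ∈ discSector d (s * α) (s * r),
      (b : ℂ) * t ∈ discSector d (s * α) (s * r) := fun s hs t ht =>
    real_smul_mem_discSector (by positivity) hb.le hb₁ ht
  refine ⟨‖A‖ + 2, by linarith [norm_nonneg A], 1, fun f u R hf hu => ?_⟩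
  refine ⟨fun t => A • f (b * t), ?_, fun t ht => ?_, fun G s s' hm hp hs' hs hs₂ hfG t ht => ?_⟩
  · exact (hf.comp (by fun_prop) (hmaps 2 two_pos)).const_smul A
  · convert! (hu _ (norm_real_smul_lt hb ht)).const_smul A using 2 with n
    rw [smul_smul, smul_smul, mul_pow]
    congr 1
    ring
  · have hδ : 0 < s - s' := sub_pos.mpr hs
    have hp0 := hp ‖t‖ (norm_nonneg t)
    have ht' : (b : ℂ) * t ∈ discSector d (s * α) (s * r) :=
      discSector_mono (by nlinarith) (by nlinarith) (hmaps s' (by linarith) t ht)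
    have hle : ‖(b : ℂ) * t‖ ≤ ‖t‖ := by
      rw [norm_mul, Complex.norm_real, Real.norm_of_nonneg hb.le]
      nlinarith [norm_nonneg t]
    rw [norm_smul, pow_one]
    have h₁ := (hfG _ ht').trans (hm (norm_nonneg _) (norm_nonneg _) hle)
    refine mul_le_mul ?_ h₁ (norm_nonneg _) (by positivity)
    rw [le_div_iff₀ hδ]
    nlinarith [norm_nonneg A]

theorem const (hα : 0 < α) (hr : 0 < r) (A : ℂ) : IsTameMultiplier E d α r 1 (fun _ => A) := by
  simpa using const_mul_pow (E := E) (d := d) hα hr one_pos le_rfl A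

theorem sum {ι : Type*} {s : Finset ι} {c : ι → ℕ → ℂ} (hα : 0 < α) (hr : 0 < r) (hb : 0 < b)
    (hb₁ : b ≤ 1) (h : ∀ i ∈ s, IsTameMultiplier E d α r b (c i)) :
    IsTameMultiplier E d α r b (fun n => ∑ i ∈ s, c i n) := by
  classical
  induction s using Finset.induction_on with
  | empty => simpa using const_mul_pow (E := E) (d := d) hα hr hb hb₁ 0
  | insert i s hi ih =>
    simp only [Finset.sum_insert hi]
    exact (h i (Finset.mem_insert_self i s)).add
      (ih fun j hj => h j (Finset.mem_insert_of_mem hj))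

/-- The multiplier `n * bⁿ` is the Euler operator `t * d/dt` followed by a contraction. The
derivative is controlled by Cauchy's estimate; the contraction leaves room for the discs of
that estimate, so that bounds by a function of `‖t‖` are kept. -/
theorem natCast_mul_pow [CompleteSpace E] (hα : 0 < α) (hr : 0 < r) (hb : 0 < b) (hb₁ : b < 1) :
    IsTameMultiplier E d α r b (fun n => (n : ℂ) * (b : ℂ) ^ n) := by
  have hopen := isOpen_discSector d (2 * α) (2 * r)
  have hmaps : ∀ s : ℝ, 0 < s → ∀ t ∈ discSector d (s * α) (s * r),
      (b : ℂ) * t ∈ discSector d (s * α) (s * r) := fun s hs t ht =>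
    real_smul_mem_discSector (by positivity) hb.le hb₁.le ht
  -- The radius of the disc around `b * t` is `κ * (s - s') * ‖b * t‖`.
  obtain ⟨κ, hκ, hκ₁, hκ₂, hκ₃⟩ : ∃ κ : ℝ, 0 < κ ∧ κ ≤ 1 / 4 ∧ 4 * κ ≤ α ∧ κ ≤ 1 - b := by
    refine ⟨min (1 / 4) (min (α / 4) (1 - b)), ?_, min_le_left _ _, ?_, ?_⟩
    · exact lt_min (by norm_num) (lt_min (by linarith) (by linarith))
    · have := (min_le_right (1 / 4) (min (α / 4) (1 - b))).trans (min_le_left _ _)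
      linarith
    · exact (min_le_right _ _).trans (min_le_right _ _)
  refine ⟨1 / κ, by rw [one_le_div hκ]; linarith, 1, fun f u R hf hu => ?_⟩
  refine ⟨fun t => (b * t) • deriv f (b * t), ?_, fun t ht => ?_,
    fun G s s' hm hp hs' hs hs₂ hfG t ht => ?_⟩
  · have h₁ := (hf.deriv hopen).comp (f := fun t : ℂ => (b : ℂ) * t) (by fun_prop)
      (hmaps 2 two_pos)
    exact DifferentiableOn.smul (by fun_prop) h₁
  · have := (hu.hasSum_deriv (norm_real_smul_lt hb ht)).const_smul ((b : ℂ) * t)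
    convert! this using 2 with n
    rw [smul_smul, smul_smul]
    congr 1
    rcases n with _ | n
    · simp
    · simp only [Nat.add_sub_cancel]
      push_cast
      ring
  · have hδ : 0 < s - s' := sub_pos.mpr hs
    have hp0 := hp ‖t‖ (norm_nonneg t)
    rw [pow_one, norm_smul]
    set z : ℂ := (b : ℂ) * t with hz
    have hzS : z ∈ discSector d (s' * α) (s' * r) := hmaps s' (by linarith) t ht
    rcases (norm_nonneg z).eq_or_lt with h0 | hz0
    · rw [← h0, zero_mul]
      positivity
    have hsub := closedBall_subset_discSector (d := d) hr hκ hκ₁ hκ₂ hs' hs hs₂ hzS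
    set ρ : ℝ := κ * (s - s') * ‖z‖ with hρ
    have hρ0 : 0 < ρ := by positivity
    have hsub₂ : Metric.closedBall z ρ ⊆ discSector d (2 * α) (2 * r) :=
      hsub.trans (discSector_mono (by nlinarith) (by nlinarith))
    have hd : ‖deriv f z‖ ≤ G ‖t‖ / ρ := by
      refine Complex.norm_deriv_le_of_forall_mem_sphere_norm_le hρ0 ?_ fun w hw => ?_
      · refine (hf.mono ?_).diffContOnCl
        rw [closure_ball z hρ0.ne']
        exact hsub₂
      · have hw' := Metric.sphere_subset_closedBall hw
        refine (hfG w (hsub hw')).trans (hm (norm_nonneg _) (norm_nonneg _) ?_)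
        have hzt : ‖z‖ = b * ‖t‖ := by
          rw [hz, norm_mul, Complex.norm_real, Real.norm_of_nonneg hb.le]
        have h₁ : ‖w‖ ≤ ‖z‖ + ρ := by
          have h₂ := norm_add_le (w - z) z
          rw [sub_add_cancel, ← dist_eq_norm] at h₂
          linarith [Metric.mem_closedBall.mp hw']
        have h₂ : ρ ≤ κ * ‖t‖ := by
          rw [hρ, hzt, mul_assoc]
          have : (s - s') * (b * ‖t‖) ≤ ‖t‖ := by
            have h₃ : b * ‖t‖ ≤ ‖t‖ := by nlinarith [norm_nonneg t]
            have h₄ : 0 ≤ b * ‖t‖ := by positivity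
            nlinarith
          gcongr
        nlinarith [norm_nonneg t]
    calc ‖z‖ * ‖deriv f z‖ ≤ ‖z‖ * (G ‖t‖ / ρ) := by gcongr
      _ = 1 / κ / (s - s') * G ‖t‖ := by rw [hρ]; field_simp

/-- The holomorphic extension of `∑ uₙ / (n + μ) tⁿ` is `t ↦ ∫₀¹ x^(μ - 1) f(x t) dx`. -/
theorem inv_natCast_add [CompleteSpace E] (hα : 0 < α) (hr : 0 < r) {μ : ℂ} (hμ : 1 < μ.re) :
    IsTameMultiplier E d α r 1 (fun n => ((n : ℂ) + μ)⁻¹) := by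
  have hopen := isOpen_discSector d (2 * α) (2 * r)
  have hcont : Continuous fun x : ℝ => (x : ℂ) ^ (μ - 1) :=
    Complex.continuous_ofReal_cpow_const (by simpa using hμ)
  have hker : ∀ x ∈ Set.Ioc (0 : ℝ) 1, ‖(x : ℂ) ^ (μ - 1)‖ ≤ 1 := fun x hx => by
    rw [Complex.norm_cpow_eq_rpow_re_of_pos hx.1]
    exact Real.rpow_le_one hx.1.le hx.2 (by simpa using hμ.le)
  have hI : Set.uIoc (0 : ℝ) 1 = Set.Ioc 0 1 := Set.uIoc_of_le zero_le_one
  have hII : Set.uIcc (0 : ℝ) 1 = Set.Icc 0 1 := Set.uIcc_of_le zero_le_one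
  have hmaps : ∀ s : ℝ, 0 < s → ∀ t ∈ discSector d (s * α) (s * r), ∀ x ∈ Set.Icc (0 : ℝ) 1,
      (x : ℂ) * t ∈ discSector d (s * α) (s * r) := fun s hs t ht x hx =>
    real_smul_mem_discSector (by positivity) hx.1 hx.2 ht
  refine ⟨2, one_le_two, 1, fun f u R hf hu => ?_⟩
  have hdf : ContinuousOn (deriv f) (discSector d (2 * α) (2 * r)) :=
    (hf.deriv hopen).continuousOn
  have hray : ∀ {h : ℂ → E}, ContinuousOn h (discSector d (2 * α) (2 * r)) →
      ∀ t ∈ discSector d (2 * α) (2 * r),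
        ContinuousOn (fun x : ℝ => h ((x : ℂ) * t)) (Set.Icc 0 1) := fun hh t ht =>
    hh.comp (by fun_prop) (hmaps 2 two_pos t ht)
  refine ⟨fun t => ∫ x in (0 : ℝ)..1, (x : ℂ) ^ (μ - 1) • f ((x : ℂ) * t), ?_, fun t ht => ?_,
    fun G s s' hm hp hs' hs hs₂ hfG t ht => ?_⟩
  · intro t₀ ht₀
    obtain ⟨ε, hε, hball⟩ := Metric.nhds_basis_closedBall.mem_iff.mp (hopen.mem_nhds ht₀)
    have hK : IsCompact ((fun q : ℝ × ℂ => (q.1 : ℂ) * q.2) ''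
        (Set.Icc (0 : ℝ) 1 ×ˢ Metric.closedBall t₀ ε)) :=
      (isCompact_Icc.prod (isCompact_closedBall t₀ ε)).image (by fun_prop)
    obtain ⟨M, hM⟩ := hK.exists_bound_of_continuousOn (hdf.mono (by
      rintro _ ⟨⟨x, t⟩, ⟨hx, ht⟩, rfl⟩
      exact hmaps 2 two_pos t (hball ht) x hx))
    refine (intervalIntegral.hasDerivAt_integral_of_dominated_loc_of_deriv_le
      (F' := fun t x => (x : ℂ) ^ (μ - 1) • ((x : ℂ) • deriv f ((x : ℂ) * t)))
      (bound := fun _ => M) (Metric.closedBall_mem_nhds t₀ hε) ?_ ?_ ?_ ?_ ?_ ?_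
      ).2.differentiableAt.differentiableWithinAt
    · filter_upwards [hopen.mem_nhds ht₀] with t ht
      rw [hI]
      exact ((hcont.continuousOn.smul (hray hf.continuousOn t ht)).mono
        Set.Ioc_subset_Icc_self).aestronglyMeasurable measurableSet_Ioc
    · refine ContinuousOn.intervalIntegrable ?_
      rw [hII]
      exact hcont.continuousOn.smul (hray hf.continuousOn t₀ ht₀)
    · rw [hI]
      exact ((hcont.continuousOn.smul (Complex.continuous_ofReal.continuousOn.smul
        (hray hdf t₀ ht₀))).mono
        Set.Ioc_subset_Icc_self).aestronglyMeasurable measurableSet_Ioc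
    · refine Filter.Eventually.of_forall fun x hx t ht => ?_
      rw [hI] at hx
      have h₁ := hM _ ⟨(x, t), ⟨Set.Ioc_subset_Icc_self hx, ht⟩, rfl⟩
      rw [norm_smul, norm_smul, Complex.norm_real, Real.norm_of_nonneg hx.1.le]
      calc _ ≤ 1 * (1 * M) := by
            gcongr
            · exact mul_nonneg hx.1.le (norm_nonneg _)
            · exact hker x hx
            · exact hx.2
        _ = M := by ring
    · exact intervalIntegrable_const
    · refine Filter.Eventually.of_forall fun x hx t ht => ?_
      rw [hI] at hx
      have h₁ : HasDerivAt f (deriv f ((x : ℂ) * t)) ((x : ℂ) * t) :=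
        (hf.differentiableAt (hopen.mem_nhds
          (hmaps 2 two_pos t (hball ht) x (Set.Ioc_subset_Icc_self hx)))).hasDerivAt
      have h₂ : HasDerivAt (fun t : ℂ => (x : ℂ) * t) (x : ℂ) t := by
        simpa using (hasDerivAt_id t).const_mul (x : ℂ)
      exact (h₁.scomp t h₂).const_smul _
  · rw [div_one] at ht
    have hle : ∀ x ∈ Set.Ioc (0 : ℝ) 1, ‖(x : ℂ) * t‖ ≤ ‖t‖ := fun x hx => by
      rw [norm_mul, Complex.norm_real, Real.norm_of_nonneg hx.1.le]
      exact mul_le_of_le_one_left (norm_nonneg t) hx.2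
    have hval : ∀ n : ℕ, ∫ x in (0 : ℝ)..1, (x : ℂ) ^ (μ - 1) • (((x : ℂ) * t) ^ n • u n) =
        t ^ n • ((n : ℂ) + μ)⁻¹ • u n := fun n => by
      have h₁ : ∀ x ∈ Set.uIcc (0 : ℝ) 1, (x : ℂ) ^ (μ - 1) • (((x : ℂ) * t) ^ n • u n) =
          (x : ℂ) ^ (μ - 1 + n) • (t ^ n • u n) := fun x hx => by
        rw [smul_smul, smul_smul]
        congr 1
        rcases eq_or_ne x 0 with rfl | hx0
        · rw [Complex.ofReal_zero, Complex.zero_cpow, Complex.zero_cpow, zero_mul, zero_mul]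
          · intro h
            have := congrArg Complex.re h
            simp only [Complex.add_re, Complex.sub_re, Complex.one_re, Complex.natCast_re,
              Complex.zero_re] at this
            have hn : (0 : ℝ) ≤ n := n.cast_nonneg
            linarith
          · intro h
            have := congrArg Complex.re h
            simp only [Complex.sub_re, Complex.one_re, Complex.zero_re] at this
            linarith
        · rw [Complex.cpow_add _ _ (by exact_mod_cast hx0), Complex.cpow_natCast, mul_pow,
            mul_assoc]
      rw [intervalIntegral.integral_congr h₁, intervalIntegral.integral_smul_const,
        integral_cpow]
      · have h₂ : μ - 1 + n + 1 = n + μ := by ring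
        have h₃ : (n : ℂ) + μ ≠ 0 := by
          intro h
          have := congrArg Complex.re h
          simp only [Complex.add_re, Complex.natCast_re, Complex.zero_re] at this
          have hn : (0 : ℝ) ≤ n := n.cast_nonneg
          linarith
        rw [h₂, Complex.ofReal_one, Complex.one_cpow, Complex.ofReal_zero,
          Complex.zero_cpow h₃, sub_zero, one_div, smul_comm]
      · left
        simp only [Complex.add_re, Complex.sub_re, Complex.one_re, Complex.natCast_re]
        have hn : (0 : ℝ) ≤ n := n.cast_nonneg
        linarith
    simp only [← hval]
    refine intervalIntegral.hasSum_integral_of_dominated_convergence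
      (fun n _ => ‖t‖ ^ n * ‖u n‖) (fun n => ?_) (fun n => ?_) ?_ ?_ ?_
    · exact Continuous.aestronglyMeasurable (hcont.smul (by fun_prop))
    · refine Filter.Eventually.of_forall fun x hx => ?_
      rw [hI] at hx
      rw [norm_smul, norm_smul, norm_pow]
      calc _ ≤ 1 * (‖t‖ ^ n * ‖u n‖) := by
            gcongr
            · exact hker x hx
            · exact hle x hx
        _ = _ := one_mul _
    · exact Filter.Eventually.of_forall fun x _ => hu.summable_norm ht
    · exact intervalIntegrable_const
    · refine Filter.Eventually.of_forall fun x hx => ?_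
      rw [hI] at hx
      exact (hu _ ((hle x hx).trans_lt ht)).const_smul _
  · have hδ : 0 < s - s' := sub_pos.mpr hs
    have hp0 := hp ‖t‖ (norm_nonneg t)
    have h₁ : ‖∫ x in (0 : ℝ)..1, (x : ℂ) ^ (μ - 1) • f ((x : ℂ) * t)‖ ≤ G ‖t‖ * |1 - 0| := by
      refine intervalIntegral.norm_integral_le_of_norm_le_const fun x hx => ?_
      rw [hI] at hx
      have hle : ‖(x : ℂ) * t‖ ≤ ‖t‖ := by
        rw [norm_mul, Complex.norm_real, Real.norm_of_nonneg hx.1.le]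
        exact mul_le_of_le_one_left (norm_nonneg t) hx.2
      have hxt : (x : ℂ) * t ∈ discSector d (s * α) (s * r) :=
        discSector_mono (by nlinarith) (by nlinarith)
          (hmaps s' (by linarith) t ht x (Set.Ioc_subset_Icc_self hx))
      rw [norm_smul]
      calc _ ≤ 1 * G ‖t‖ := by
            gcongr
            · exact hker x hx
            · exact (hfG _ hxt).trans (hm (norm_nonneg _) (norm_nonneg _) hle)
        _ = _ := one_mul _
    refine h₁.trans ?_
    rw [sub_zero, abs_one, mul_one, pow_one]
    refine le_mul_of_one_le_left hp0 ?_
    rw [one_le_div hδ]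
    linarith

end IsTameMultiplier

end

/-! ### Multipliers preserving continuation with exponential growth -/

section

variable {E : Type u} [NormedAddCommGroup E] [NormedSpace ℂ E]

/-- The power series `∑ uₙ tⁿ` converges near `0` and its sum extends to a holomorphic function of
exponential growth of order at most `k` on some disc-sector in the direction `d`. By definition,
`∑ uₙ tⁿ` is `k`-summable in the direction `d` if its Borel transform of order `k` has this
property. -/
def IsExtendable (k d : ℝ) (u : ℕ → E) : Prop :=
  ∃ α r : ℝ, 0 < α ∧ 0 < r ∧ ∃ f : ℂ → E, HasExpGrowth k d α r f ∧ IsExpansionAtZero u f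

/-- Shrinking the disc-sector turns the family of growth bounds into a single one. -/
theorem isExtendable_iff {k d : ℝ} {u : ℕ → E} :
    IsExtendable k d u ↔ ∃ α r : ℝ, 0 < α ∧ 0 < r ∧ ∃ (f : ℂ → E) (A B R : ℝ),
      0 ≤ A ∧ 0 ≤ B ∧ 0 < R ∧ DifferentiableOn ℂ f (discSector d α r) ∧
      (∀ t ∈ discSector d α r, ‖f t‖ ≤ A * Real.exp (B * ‖t‖ ^ k)) ∧ ExpandsOn u f R := by
  constructor
  · rintro ⟨α, r, hα, hr, f, ⟨hf, hG⟩, hu⟩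
    obtain ⟨R, hR, hu⟩ := isExpansionAtZero_iff.mp hu
    obtain ⟨A, B, hA, hB, hAB⟩ := hG (α / 2) ⟨by linarith, by linarith⟩ (r / 2)
      ⟨by linarith, by linarith⟩
    exact ⟨α / 2, r / 2, by linarith, by linarith, f, A, B, R, hA.le, hB.le, hR,
      hf.mono (discSector_mono (by linarith) (by linarith)), fun t ht => (hAB t ht).le, hu⟩
  · rintro ⟨α, r, hα, hr, f, A, B, R, hA, hB, hR, hf, hAB, hu⟩
    refine ⟨α, r, hα, hr, f, ⟨hf, fun α' hα' r' hr' => ⟨A + 1, B + 1, by linarith, by linarith,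
      fun t ht => ?_⟩⟩, isExpansionAtZero_iff.mpr ⟨R, hR, hu⟩⟩
    have h₁ := hAB t (discSector_mono hα'.2.le hr'.2.le ht)
    have h₂ : 0 ≤ ‖t‖ ^ k := Real.rpow_nonneg (norm_nonneg t) k
    calc ‖f t‖ ≤ A * Real.exp (B * ‖t‖ ^ k) := h₁
      _ ≤ A * Real.exp ((B + 1) * ‖t‖ ^ k) := by gcongr; linarith
      _ < (A + 1) * Real.exp ((B + 1) * ‖t‖ ^ k) := by gcongr; linarith

/-- Multiplication of the coefficients by `c` preserves `IsExtendable k d`. -/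
def PreservesExtendability (E : Type u) [NormedAddCommGroup E] [NormedSpace ℂ E] (k d : ℝ)
    (c : ℕ → ℂ) : Prop :=
  ∀ u : ℕ → E, IsExtendable k d u → IsExtendable k d (fun n => c n • u n)

theorem monotoneOn_mul_exp_rpow {k A B : ℝ} (hk : 0 < k) (hA : 0 ≤ A) (hB : 0 ≤ B) :
    MonotoneOn (fun x : ℝ => A * Real.exp (B * x ^ k)) (Set.Ici 0) := fun x hx y _ hxy => by
  have := Real.rpow_le_rpow hx hxy hk.le
  dsimp only
  gcongr

/-- The factor `x` is absorbed by an exponential of `x ^ k`, for every `k > 0`. -/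
theorem exists_le_mul_exp_rpow {k : ℝ} (hk : 0 < k) :
    ∃ A : ℝ, 0 ≤ A ∧ ∀ x : ℝ, 0 ≤ x → x ≤ A * Real.exp (x ^ k) := by
  obtain ⟨n, hn⟩ := exists_nat_gt (1 / k)
  refine ⟨n.factorial, by positivity, fun x hx => ?_⟩
  have hf : (1 : ℝ) ≤ n.factorial := by exact_mod_cast n.factorial_pos
  have hxk : 0 ≤ x ^ k := Real.rpow_nonneg hx k
  rcases le_total x 1 with h | h
  · nlinarith [Real.one_le_exp hxk]
  · have h₁ : x ≤ (x ^ k) ^ n := by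
      rw [← Real.rpow_natCast, ← Real.rpow_mul hx]
      calc x = x ^ (1 : ℝ) := (Real.rpow_one x).symm
        _ ≤ x ^ (k * n) := Real.rpow_le_rpow_of_exponent_le h (by
            rw [div_lt_iff₀ hk] at hn
            linarith)
    have h₂ := Real.pow_div_factorial_le_exp (x ^ k) hxk n
    rw [div_le_iff₀ (by positivity)] at h₂
    linarith

namespace PreservesExtendability

variable {k d : ℝ} {c c' : ℕ → ℂ}

theorem mul (h : PreservesExtendability E k d c) (h' : PreservesExtendability E k d c') :
    PreservesExtendability E k d (fun n => c n * c' n) := fun u hu => by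
  simpa only [smul_smul] using h _ (h' u hu)

theorem pow {a : ℝ} (ha : 0 < a) : PreservesExtendability E k d (fun n => (a : ℂ) ^ n) := by
  intro u hu
  obtain ⟨α, r, hα, hr, f, A, B, R, hA, hB, hR, hf, hAB, hu⟩ := isExtendable_iff.mp hu
  have hmaps : ∀ t ∈ discSector d α (r / a), (a : ℂ) * t ∈ discSector d α r := by
    rintro t (⟨ρ, φ, hρ, hφ, rfl⟩ | ht)
    · exact Or.inl ⟨a * ρ, φ, by positivity, hφ, by push_cast; ring⟩
    · refine Or.inr ?_
      rw [mem_ball_zero_iff] at ht ⊢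
      exact norm_real_smul_lt ha ht
  refine isExtendable_iff.mpr ⟨α, r / a, hα, by positivity, fun t => f (a * t), A, B * a ^ k,
    R / a, hA, by positivity, by positivity, hf.comp (by fun_prop) hmaps, fun t ht => ?_,
    fun t ht => ?_⟩
  · convert! hAB _ (hmaps t ht) using 3
    rw [norm_mul, Complex.norm_real, Real.norm_of_nonneg ha.le,
      Real.mul_rpow ha.le (norm_nonneg t), mul_assoc]
  · convert! hu _ (norm_real_smul_lt ha ht) using 2 with n
    rw [smul_smul, mul_pow, mul_comm]

theorem of_isTameMultiplier {b : ℝ} (hk : 0 < k) (hb : 0 < b)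
    (h : ∀ α r : ℝ, 0 < α → 0 < r → IsTameMultiplier E d α r b c) :
    PreservesExtendability E k d c := by
  intro u hu
  obtain ⟨α, r, hα, hr, f, A, B, R, hA, hB, hR, hf, hAB, hu⟩ := isExtendable_iff.mp hu
  obtain ⟨C, hC, p, h⟩ := h (α / 2) (r / 2) (by linarith) (by linarith)
  rw [← mul_div_cancel₀ α (two_ne_zero' ℝ), ← mul_div_cancel₀ r (two_ne_zero' ℝ)] at hf hAB
  obtain ⟨g, hg, hgu, hG⟩ := h f u R hf hu
  have hbd := hG _ 2 1 (monotoneOn_mul_exp_rpow hk hA hB) (fun x _ => by positivity) le_rfl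
    one_lt_two le_rfl hAB
  refine isExtendable_iff.mpr ⟨1 * (α / 2), 1 * (r / 2), by linarith, by linarith, g,
    (C / (2 - 1)) ^ p * A, B, R / b, ?_, hB, by positivity,
    hg.mono (discSector_mono (by linarith) (by linarith)), fun t ht => ?_, hgu⟩
  · exact mul_nonneg (pow_nonneg (div_nonneg (by linarith) (by norm_num)) _) hA
  · rw [mul_assoc]
    exact hbd t ht

end PreservesExtendability

/-- Dropping the constant term and dividing by `t`. -/
theorem IsExtendable.tail [CompleteSpace E] {k d : ℝ} {u : ℕ → E}
    (hu : IsExtendable k d u) : IsExtendable k d (fun n => u (n + 1)) := by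
  obtain ⟨α, r, hα, hr, f, A, B, R, hA, hB, hR, hf, hAB, hu⟩ := isExtendable_iff.mp hu
  have hopen := isOpen_discSector d α r
  have h0 : f 0 = u 0 := by
    have h₁ := hu 0 (by simpa using hR)
    refine h₁.unique ?_
    convert! hasSum_single (f := fun n : ℕ => (0 : ℂ) ^ n • u n) 0 (fun n hn => by simp [hn])
      using 1
    simp
  have hg : DifferentiableOn ℂ (dslope f 0) (discSector d α r) :=
    (Complex.differentiableOn_dslope (hopen.mem_nhds (zero_mem_discSector hr))).mpr hf
  obtain ⟨M, hM⟩ := (isCompact_closedBall (0 : ℂ) (r / 2)).exists_bound_of_continuousOn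
    (hg.continuousOn.mono fun t ht => Or.inr (Metric.closedBall_subset_ball (by linarith) ht))
  have hM0 : 0 ≤ M := (norm_nonneg _).trans (hM 0 (Metric.mem_closedBall_self (by linarith)))
  refine isExtendable_iff.mpr ⟨α, r, hα, hr, dslope f 0, M + 2 / r * (A + ‖u 0‖), B, R,
    by positivity, hB, hR, hg, fun t ht => ?_, fun t ht => ?_⟩
  · have hexp : 1 ≤ Real.exp (B * ‖t‖ ^ k) :=
      Real.one_le_exp (mul_nonneg hB (Real.rpow_nonneg (norm_nonneg t) k))
    have hc : 0 ≤ 2 / r * (A + ‖u 0‖) := by positivity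
    rcases le_or_gt ‖t‖ (r / 2) with h | h
    · have := hM t (by simpa using h)
      nlinarith
    · have ht0 : t ≠ 0 := norm_pos_iff.mp (by linarith)
      rw [dslope_of_ne _ ht0, slope_def_module, sub_zero, norm_smul, norm_inv, h0]
      have h₁ : ‖f t - u 0‖ ≤ (A + ‖u 0‖) * Real.exp (B * ‖t‖ ^ k) := by
        have := norm_sub_le (f t) (u 0)
        have := hAB t ht
        nlinarith [norm_nonneg (u 0)]
      have h₂ : ‖t‖⁻¹ ≤ 2 / r := by
        rw [inv_le_comm₀ (by linarith) (by positivity), inv_div]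
        exact h.le
      calc ‖t‖⁻¹ * ‖f t - u 0‖
          ≤ 2 / r * ((A + ‖u 0‖) * Real.exp (B * ‖t‖ ^ k)) := by gcongr
        _ ≤ _ := by nlinarith
  · rcases eq_or_ne t 0 with rfl | ht0
    · rw [dslope_same]
      have h₁ := (hasSum_nat_add_iff' 1).mpr (hu.hasSum_deriv ht)
      convert! h₁ using 1
      · funext n
        rcases n with _ | n <;> simp
      · simp
    · rw [dslope_of_ne _ ht0, slope_def_module, sub_zero, h0]
      have h₁ := ((hasSum_nat_add_iff' 1).mpr (hu t ht)).const_smul t⁻¹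
      simp only [Finset.range_one, Finset.sum_singleton, pow_zero, one_smul] at h₁
      convert! h₁ using 2 with n
      rw [smul_smul, pow_succ, mul_comm, mul_assoc, mul_inv_cancel₀ ht0, mul_one]

/-- Multiplying by `t` and adding a constant term. -/
theorem IsExtendable.of_tail {k d : ℝ} (hk : 0 < k) {u : ℕ → E}
    (hu : IsExtendable k d (fun n => u (n + 1))) : IsExtendable k d u := by
  obtain ⟨α, r, hα, hr, f, A, B, R, hA, hB, hR, hf, hAB, hu⟩ := isExtendable_iff.mp hu
  obtain ⟨D, hD, hDx⟩ := exists_le_mul_exp_rpow hk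
  refine isExtendable_iff.mpr ⟨α, r, hα, hr, fun t => u 0 + t • f t, ‖u 0‖ + D * A, B + 1, R,
    by positivity, by positivity, hR, ?_, fun t ht => ?_, fun t ht => ?_⟩
  · exact (differentiableOn_const _).add (differentiableOn_id.smul hf)
  · have htk : 0 ≤ ‖t‖ ^ k := Real.rpow_nonneg (norm_nonneg t) k
    have hexp : 1 ≤ Real.exp ((B + 1) * ‖t‖ ^ k) :=
      Real.one_le_exp (mul_nonneg (by linarith) htk)
    have h₁ : ‖t • f t‖ ≤ D * A * Real.exp ((B + 1) * ‖t‖ ^ k) := by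
      rw [norm_smul, add_mul, Real.exp_add, one_mul]
      calc ‖t‖ * ‖f t‖ ≤ (D * Real.exp (‖t‖ ^ k)) * (A * Real.exp (B * ‖t‖ ^ k)) := by
            gcongr
            · exact hDx _ (norm_nonneg t)
            · exact hAB t ht
        _ = _ := by ring
    have h₂ := norm_add_le (u 0) (t • f t)
    nlinarith [norm_nonneg (u 0)]
  · rw [← hasSum_nat_add_iff' 1]
    convert! (hu t ht).const_smul t using 1
    · funext n
      rw [smul_smul, pow_succ, mul_comm]
    · simp

theorem PreservesExtendability.of_shift [CompleteSpace E] {k d : ℝ} {c : ℕ → ℂ} (hk : 0 < k)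
    (N : ℕ) (h : PreservesExtendability E k d (fun n => c (n + N))) :
    PreservesExtendability E k d c := by
  induction N generalizing c with
  | zero => exact h
  | succ N ih =>
    refine fun u hu => IsExtendable.of_tail hk ?_
    exact ih (c := fun n => c (n + 1)) h _ hu.tail

end

/-! ### Inversion by a Neumann series -/

/-- Quantities of size `J ^ (p * J)` are negligible against `exp (κ * β ^ J)` for `β > 1`. -/
theorem exists_mul_pow_le_exp {C κ γ : ℝ} (p : ℕ) (hC : 1 ≤ C) (hκ : 0 < κ) (hγ : 1 < γ) :
    ∃ A : ℝ, 0 ≤ A ∧ ∀ J : ℕ, J * (C * J) ^ (p * J) ≤ A * Real.exp (κ * (γ ^ 2) ^ J) := by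
  obtain ⟨D, hD⟩ := (tendsto_pow_const_div_const_pow_of_one_lt 2 hγ).bddAbove_range
  have hD' : ∀ J : ℕ, (J : ℝ) ^ 2 ≤ D * γ ^ J := fun J => by
    rw [← div_le_iff₀ (by positivity)]
    exact hD ⟨J, rfl⟩
  set L : ℝ := (1 + p * C) * D with hL
  have hpC : 0 ≤ 1 + p * C := by positivity
  refine ⟨Real.exp (L ^ 2 / (4 * κ)), (Real.exp_pos _).le, fun J => ?_⟩
  have h₁ : (J : ℝ) ≤ Real.exp J := by linarith [Real.add_one_le_exp (J : ℝ)]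
  have h₂ : C * J ≤ Real.exp (C * J) := by linarith [Real.add_one_le_exp (C * J)]
  have hJ : (J : ℝ) ≤ (J : ℝ) ^ 2 := by exact_mod_cast Nat.le_self_pow two_ne_zero J
  have hCJ : 0 ≤ C * J := by positivity
  calc J * (C * J) ^ (p * J) ≤ Real.exp J * Real.exp (C * J) ^ (p * J) := by gcongr
    _ = Real.exp (J + p * C * (J : ℝ) ^ 2) := by
        rw [← Real.exp_nat_mul, ← Real.exp_add]
        push_cast
        ring_nf
    _ ≤ Real.exp (L ^ 2 / (4 * κ) + κ * (γ ^ 2) ^ J) := by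
        refine Real.exp_le_exp.mpr ?_
        have h₃ : J + p * C * (J : ℝ) ^ 2 ≤ L * γ ^ J := by
          calc J + p * C * (J : ℝ) ^ 2 ≤ (1 + p * C) * (J : ℝ) ^ 2 := by linarith
            _ ≤ (1 + p * C) * (D * γ ^ J) := mul_le_mul_of_nonneg_left (hD' J) hpC
            _ = L * γ ^ J := by rw [hL, mul_assoc]
        -- The inequality `L * x ≤ L ^ 2 / (4 * κ) + κ * x ^ 2` is a completed square.
        have h₄ : L ^ 2 / (4 * κ) + κ * (γ ^ 2) ^ J - L * γ ^ J =
            κ * (γ ^ J - L / (2 * κ)) ^ 2 := by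
          rw [← pow_mul, mul_comm 2 J, pow_mul]
          field_simp
          ring
        have h₅ : 0 ≤ κ * (γ ^ J - L / (2 * κ)) ^ 2 := by positivity
        linarith
    _ = _ := Real.exp_add _ _

section

variable {E : Type u} [NormedAddCommGroup E] [NormedSpace ℂ E]

/-- The functions `F j` extending `∑ εₙʲ uₙ tⁿ` that a tame multiplier `ε` produces by iteration.
Reaching `F j` in `J ≥ j` equal steps costs a factor `(C * J) ^ (p * j)`. -/
theorem IsTameMultiplier.exists_iterates {d α r ϑ : ℝ} {ε : ℕ → ℂ}
    (h : IsTameMultiplier E d α r ϑ ε) :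
    ∃ C : ℝ, 1 ≤ C ∧ ∃ p : ℕ, ∀ (f : ℂ → E) (u : ℕ → E) (R : ℝ),
      DifferentiableOn ℂ f (discSector d (2 * α) (2 * r)) → ExpandsOn u f R →
      ∃ F : ℕ → ℂ → E, (∀ j, DifferentiableOn ℂ (F j) (discSector d (2 * α) (2 * r))) ∧
        (∀ j, ExpandsOn (fun n => ε n ^ j • u n) (F j) (R / ϑ ^ j)) ∧
        ∀ G : ℝ → ℝ, MonotoneOn G (Set.Ici 0) → (∀ x, 0 ≤ x → 0 ≤ G x) →
          (∀ t ∈ discSector d (2 * α) (2 * r), ‖f t‖ ≤ G ‖t‖) →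
          ∀ J j : ℕ, j ≤ J → ∀ t ∈ discSector d ((2 - j / J) * α) ((2 - j / J) * r),
            ‖F j t‖ ≤ (C * J) ^ (p * j) * G ‖t‖ := by
  obtain ⟨C, hC, p, h⟩ := h
  refine ⟨C, hC, p, fun f u R hf hu => ?_⟩
  choose! T hTd hTu hTG using h
  let F : ℕ → ℂ → E := fun j =>
    Nat.rec f (fun j g => T g (fun n => ε n ^ j • u n) (R / ϑ ^ j)) j
  have hF0 : F 0 = f := rfl
  have hFs : ∀ j, F (j + 1) = T (F j) (fun n => ε n ^ j • u n) (R / ϑ ^ j) := fun j => rfl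
  have hF : ∀ j, DifferentiableOn ℂ (F j) (discSector d (2 * α) (2 * r)) ∧
      ExpandsOn (fun n => ε n ^ j • u n) (F j) (R / ϑ ^ j) := by
    intro j
    induction j with
    | zero => simpa [hF0] using ⟨hf, hu⟩
    | succ j ih =>
      rw [hFs]
      refine ⟨hTd _ _ _ ih.1 ih.2, ?_⟩
      have := hTu _ _ _ ih.1 ih.2
      simpa only [smul_smul, pow_succ', div_div, mul_comm (ϑ ^ j)] using this
  refine ⟨F, fun j => (hF j).1, fun j => (hF j).2, fun G hm hp hfG J j => ?_⟩
  induction j with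
  | zero => simpa [hF0] using hfG
  | succ j ih =>
    intro hj
    have hJ : (0 : ℝ) < J := by exact_mod_cast (Nat.succ_pos j).trans_le hj
    have hj' : ((j : ℝ) + 1) / J ≤ 1 := by
      rw [div_le_one hJ]
      exact_mod_cast hj
    have hpow : 0 ≤ (C * J) ^ (p * j) := by positivity
    have := hTG _ _ _ (hF j).1 (hF j).2 (fun x => (C * J) ^ (p * j) * G x)
      (2 - (j : ℝ) / J) (2 - ((j : ℝ) + 1) / J)
      (fun x hx y hy hxy => mul_le_mul_of_nonneg_left (hm hx hy hxy) hpow)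
      (fun x hx => mul_nonneg hpow (hp x hx)) (by linarith)
      (by
        gcongr
        linarith)
      (by
        have : 0 ≤ (j : ℝ) / J := by positivity
        linarith) (ih (Nat.le_of_succ_le hj))
    intro t ht
    push_cast at ht
    rw [hFs]
    refine (this t ht).trans_eq ?_
    have e₁ : (2 - (j : ℝ) / J) - (2 - ((j : ℝ) + 1) / J) = 1 / J := by ring
    rw [e₁, div_div_eq_mul_div, div_one, ← mul_assoc, ← pow_add]
    ring_nf

/-- If `ε` is tame and small, then `(1 + εₙ)⁻¹ = ∑ (-εₙ)ʲ` preserves extendability. At a point `t`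
the terms with `ϑʲ ‖t‖` small are controlled by the power series; the number `J` of other terms
is of order `log ‖t‖`, so their cost `J ^ O(J)` is smaller than `exp (‖t‖ ^ k)`. -/
theorem PreservesExtendability.inv_one_add [CompleteSpace E] {k d ϑ : ℝ} {ε : ℕ → ℂ} (hk : 0 < k)
    (hϑ : 0 < ϑ) (hϑ₁ : ϑ < 1) (h : ∀ α r : ℝ, 0 < α → 0 < r → IsTameMultiplier E d α r ϑ ε)
    (hε : ∀ n, ‖ε n‖ ≤ ϑ ^ (n + 1)) :
    PreservesExtendability E k d (fun n => (1 + ε n)⁻¹) := by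
  intro u hu
  obtain ⟨α₂, r₂, hα₂, hr₂, f, A, B, R, hA, hB, hR, hf, hAB, hu⟩ := isExtendable_iff.mp hu
  obtain ⟨α, rfl⟩ : ∃ α, α₂ = 2 * α := ⟨α₂ / 2, by ring⟩
  obtain ⟨r, rfl⟩ : ∃ r, r₂ = 2 * r := ⟨r₂ / 2, by ring⟩
  have hα : 0 < α := by linarith
  have hr : 0 < r := by linarith
  obtain ⟨C, hC, p, hF⟩ := (h α r hα hr).exists_iterates
  obtain ⟨F, hFd, hFu, hFG⟩ := hF f u R hf hu
  have hFG := hFG _ (monotoneOn_mul_exp_rpow hk hA hB) (fun x _ => by positivity) hAB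
  obtain ⟨K, hK, hKu⟩ := hu.exists_norm_coeff_le (half_pos hR) (half_lt_self hR)
  -- The terms of the double series `∑ⱼ ∑ₙ (-εₙ)ʲ uₙ tⁿ`.
  have hterm : ∀ (j n : ℕ) (t : ℂ), ϑ ^ j * ‖t‖ ≤ R / 4 →
      ‖t ^ n • ε n ^ j • u n‖ ≤ K * ϑ ^ j * (1 / 2) ^ n := fun j n t ht => by
    rw [norm_smul, norm_smul, norm_pow, norm_pow]
    calc ‖t‖ ^ n * (‖ε n‖ ^ j * ‖u n‖)
        ≤ ‖t‖ ^ n * ((ϑ ^ (n + 1)) ^ j * (K * ((R / 2)⁻¹) ^ n)) := by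
          gcongr
          · exact hε n
          · exact hKu n
      _ = K * ϑ ^ j * (ϑ ^ j * ‖t‖ * (R / 2)⁻¹) ^ n := by ring
      _ ≤ K * ϑ ^ j * (R / 4 * (R / 2)⁻¹) ^ n := by gcongr
      _ = K * ϑ ^ j * (1 / 2) ^ n := by
          congr 2
          field_simp
          norm_num
  have hfar : ∀ (j : ℕ) (t : ℂ), ϑ ^ j * ‖t‖ ≤ R / 4 → ‖F j t‖ ≤ 2 * K * ϑ ^ j := fun j t ht => by
    have ht' : ‖t‖ < R / ϑ ^ j := by
      rw [lt_div_iff₀ (by positivity)]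
      linarith
    rw [← (hFu j t ht').tsum_eq]
    refine tsum_of_norm_bounded ?_ fun n => hterm j n t ht
    convert! hasSum_geometric_two.mul_left (K * ϑ ^ j) using 1
    ring
  have hgeom : Summable fun j : ℕ => 2 * K * ϑ ^ j :=
    (summable_geometric_of_lt_one hϑ.le hϑ₁).mul_left _
  have hdecay : ∀ {J j : ℕ} {x : ℝ}, 0 ≤ x → J ≤ j → ϑ ^ J * x ≤ R / 4 → ϑ ^ j * x ≤ R / 4 :=
    fun hx hJj hJ => le_trans
      (mul_le_mul_of_nonneg_right (pow_le_pow_of_le_one hϑ.le hϑ₁.le hJj) hx) hJ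
  have hexists : ∀ x : ℝ, ∃ J : ℕ, ϑ ^ J * x ≤ R / 4 := fun x => by
    have h₁ := (tendsto_pow_atTop_nhds_zero_of_lt_one hϑ.le hϑ₁).mul_const x
    rw [zero_mul] at h₁
    obtain ⟨J, hJ⟩ := (h₁.eventually (gt_mem_nhds (show (0 : ℝ) < R / 4 by linarith))).exists
    exact ⟨J, hJ.le⟩
  set H : ℕ → ℂ → E := fun j t => (-1 : ℂ) ^ j • F j t with hH
  have hHn : ∀ j t, ‖H j t‖ = ‖F j t‖ := fun j t => by simp [hH, norm_smul]
  have hHtail : ∀ (J : ℕ) (t : ℂ), ϑ ^ J * ‖t‖ ≤ R / 4 →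
      ∀ j, ‖H (j + J) t‖ ≤ 2 * K * ϑ ^ j := fun J t hJ j => by
    rw [hHn]
    refine (hfar _ t (hdecay (norm_nonneg t) (Nat.le_add_left J j) hJ)).trans ?_
    have := pow_le_pow_of_le_one hϑ.le hϑ₁.le (Nat.le_add_right j J)
    gcongr
  have hsum : ∀ t, Summable fun j => H j t := fun t => by
    obtain ⟨J, hJ⟩ := hexists ‖t‖
    rw [← summable_nat_add_iff J]
    exact Summable.of_norm_bounded hgeom (hHtail J t hJ)
  have hsplit : ∀ (J : ℕ) (t : ℂ),
      ∑' j, H j t = ∑ j ∈ Finset.range J, H j t + ∑' j, H (j + J) t := fun J t =>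
    ((hsum t).sum_add_tsum_nat_add J).symm
  have hopen := isOpen_discSector d (2 * α) (2 * r)
  have hgd : DifferentiableOn ℂ (fun t => ∑' j, H j t) (discSector d (2 * α) (2 * r)) := by
    intro t₀ ht₀
    obtain ⟨J, hJ⟩ := hexists (‖t₀‖ + 1)
    have hU : IsOpen (discSector d (2 * α) (2 * r) ∩ Metric.ball 0 (‖t₀‖ + 1)) :=
      hopen.inter Metric.isOpen_ball
    have hHd : ∀ j, DifferentiableOn ℂ (H j)
        (discSector d (2 * α) (2 * r) ∩ Metric.ball 0 (‖t₀‖ + 1)) := fun j =>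
      ((hFd j).mono Set.inter_subset_left).const_smul _
    have h₁ := Complex.differentiableOn_tsum_of_summable_norm hgeom (F := fun j t => H (j + J) t)
      (fun j => hHd (j + J)) hU fun j t ht => by
        refine hHtail J t (le_trans ?_ hJ) j
        have := (mem_ball_zero_iff.mp ht.2).le
        gcongr
    have h₂ := (DifferentiableOn.fun_sum (u := Finset.range J) fun j _ => hHd j).add h₁
    refine (h₂.congr fun t _ => hsplit J t).differentiableAt
      (hU.mem_nhds ⟨ht₀, by simp⟩) |>.differentiableWithinAt
  have hgu : ExpandsOn (fun n => (1 + ε n)⁻¹ • u n) (fun t => ∑' j, H j t) (R / 4) := by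
    intro t ht
    have ht' : ∀ j, ϑ ^ j * ‖t‖ ≤ R / 4 := fun j =>
      hdecay (norm_nonneg t) (Nat.zero_le j) (by simpa using ht.le)
    have hdouble : Summable fun q : ℕ × ℕ => (-1 : ℂ) ^ q.1 • t ^ q.2 • ε q.2 ^ q.1 • u q.2 := by
      refine Summable.of_norm_bounded (g := fun q : ℕ × ℕ => K * ϑ ^ q.1 * (1 / 2) ^ q.2) ?_ ?_
      · exact ((summable_geometric_of_lt_one hϑ.le hϑ₁).mul_left K).mul_of_nonneg
          summable_geometric_two (fun j => by positivity) fun n => by positivity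
      · intro q
        rw [norm_smul, norm_pow, norm_neg, norm_one, one_pow, one_mul]
        exact hterm q.1 q.2 t (ht' q.1)
    have hrows := hdouble.hasSum.prod_fiberwise fun j => by
      refine (hFu j t ?_).const_smul ((-1 : ℂ) ^ j)
      rw [lt_div_iff₀ (by positivity), mul_comm]
      linarith [ht' j]
    have hval := hrows.unique (hsum t).hasSum
    have hswap := (Equiv.prodComm ℕ ℕ).hasSum_iff.mpr hdouble.hasSum
    rw [hval] at hswap
    refine hswap.prod_fiberwise fun n => ?_
    have hlt : ‖-ε n‖ < 1 := by
      rw [norm_neg]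
      exact (hε n).trans_lt (pow_lt_one₀ hϑ.le hϑ₁ (Nat.succ_ne_zero n))
    have h₁ := (hasSum_geometric_of_norm_lt_one hlt).smul_const (t ^ n • u n)
    rw [sub_neg_eq_add, smul_comm] at h₁
    convert! h₁ using 2 with j
    simp only [Function.comp_apply, Equiv.prodComm_apply, Prod.swap_prod_mk]
    rw [neg_pow (ε n), mul_smul, smul_comm (ε n ^ j)]
  -- The number of large terms at `t` is the least `J` with `ϑ ^ J * ‖t‖ ≤ R / 4`.
  have hγ : 1 < Real.sqrt ((ϑ⁻¹) ^ k) := by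
    rw [Real.lt_sqrt zero_le_one, one_pow]
    exact Real.one_lt_rpow ((one_lt_inv₀ hϑ).mpr hϑ₁) hk
  obtain ⟨D, hD, hDJ⟩ := exists_mul_pow_le_exp p hC
    (show 0 < (R / 4 * ϑ) ^ k by positivity) hγ
  rw [Real.sq_sqrt (by positivity)] at hDJ
  have hbound : ∀ t ∈ discSector d α r,
      ‖∑' j, H j t‖ ≤ (D * A + ∑' j, 2 * K * ϑ ^ j) * Real.exp ((B + 1) * ‖t‖ ^ k) := by
    intro t ht
    classical
    obtain ⟨J, hJ, hJmin⟩ : ∃ J : ℕ, ϑ ^ J * ‖t‖ ≤ R / 4 ∧ ∀ i < J, R / 4 < ϑ ^ i * ‖t‖ :=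
      ⟨Nat.find (hexists ‖t‖), Nat.find_spec (hexists ‖t‖),
        fun i hi => not_le.mp (Nat.find_min (hexists ‖t‖) hi)⟩
    have htk : 0 ≤ ‖t‖ ^ k := Real.rpow_nonneg (norm_nonneg t) k
    have hS0 : 0 ≤ ∑' j, 2 * K * ϑ ^ j := tsum_nonneg fun j => by positivity
    have htail : ‖∑' j, H (j + J) t‖ ≤ ∑' j, 2 * K * ϑ ^ j :=
      tsum_of_norm_bounded hgeom.hasSum (hHtail J t hJ)
    have hhead : ‖∑ j ∈ Finset.range J, H j t‖ ≤ D * A * Real.exp ((B + 1) * ‖t‖ ^ k) := by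
      rcases J with _ | i
      · simp only [Finset.range_zero, Finset.sum_empty, norm_zero]
        positivity
      set J := i + 1 with hJi
      have hJ1 : (1 : ℝ) ≤ J := by rw [hJi]; push_cast; linarith [i.cast_nonneg (α := ℝ)]
      have hCJ : 1 ≤ C * J := by nlinarith
      have hone : ∀ j ∈ Finset.range J, ‖H j t‖ ≤
          (C * J) ^ (p * J) * (A * Real.exp (B * ‖t‖ ^ k)) := fun j hj => by
        have hjJ := (Finset.mem_range.mp hj).le
        have hs : (1 : ℝ) ≤ 2 - j / J := by
          have : (j : ℝ) / J ≤ 1 := by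
            rw [div_le_one (by linarith)]
            exact_mod_cast hjJ
          linarith
        rw [hHn]
        refine (hFG J j hjJ t (discSector_mono (by nlinarith) (by nlinarith) ht)).trans ?_
        have := pow_le_pow_right₀ hCJ (Nat.mul_le_mul_left p hjJ)
        gcongr
      have hlarge : (R / 4 * ϑ) ^ k * ((ϑ⁻¹) ^ k) ^ J ≤ ‖t‖ ^ k := by
        have e₁ : ((ϑ⁻¹) ^ k) ^ J = ((ϑ⁻¹) ^ J) ^ k := by
          rw [← Real.rpow_natCast, ← Real.rpow_natCast, ← Real.rpow_mul (by positivity),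
            ← Real.rpow_mul (by positivity), mul_comm]
        rw [e₁, ← Real.mul_rpow (by positivity) (by positivity)]
        refine Real.rpow_le_rpow (by positivity) ?_ hk.le
        have h₁ := hJmin i (Nat.lt_succ_self i)
        have e₂ : R / 4 * ϑ * (ϑ⁻¹) ^ J = R / 4 / ϑ ^ i := by
          rw [hJi, inv_pow, pow_succ]
          field_simp
        rw [e₂, div_le_iff₀ (by positivity)]
        linarith
      calc ‖∑ j ∈ Finset.range J, H j t‖
          ≤ ∑ j ∈ Finset.range J, (C * J) ^ (p * J) * (A * Real.exp (B * ‖t‖ ^ k)) :=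
            norm_sum_le_of_le _ hone
        _ = (J * (C * J) ^ (p * J)) * (A * Real.exp (B * ‖t‖ ^ k)) := by
            rw [Finset.sum_const, Finset.card_range, nsmul_eq_mul, mul_assoc]
        _ ≤ (D * Real.exp (‖t‖ ^ k)) * (A * Real.exp (B * ‖t‖ ^ k)) := by
            have := (hDJ J).trans (mul_le_mul_of_nonneg_left (Real.exp_le_exp.mpr hlarge) hD)
            exact mul_le_mul_of_nonneg_right this (by positivity)
        _ = D * A * Real.exp ((B + 1) * ‖t‖ ^ k) := by
            rw [add_mul, Real.exp_add, one_mul]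
            ring
    have hexp : 1 ≤ Real.exp ((B + 1) * ‖t‖ ^ k) :=
      Real.one_le_exp (mul_nonneg (by linarith) htk)
    rw [hsplit J t]
    have h₁ := norm_add_le (∑ j ∈ Finset.range J, H j t) (∑' j, H (j + J) t)
    nlinarith
  refine isExtendable_iff.mpr ⟨α, r, hα, hr, fun t => ∑' j, H j t, _, B + 1, R / 4,
    add_nonneg (mul_nonneg hD hA) (tsum_nonneg fun j => by positivity), by linarith, by linarith,
    hgd.mono (discSector_mono (by linarith) (by linarith)), hbound, hgu⟩

end

/-! ### Rational multipliers -/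

section

variable {E : Type u} [NormedAddCommGroup E] [NormedSpace ℂ E] [CompleteSpace E]

theorem isTameMultiplier_eval_mul_pow {d α r b : ℝ} (hα : 0 < α) (hr : 0 < r) (hb : 0 < b)
    (hb₁ : b < 1) (P : Polynomial ℂ) :
    IsTameMultiplier E d α r b (fun n => P.eval (n : ℂ) * (b : ℂ) ^ n) := by
  induction P using Polynomial.induction_on' with
  | add P Q hP hQ => simpa only [Polynomial.eval_add, add_mul] using hP.add hQ
  | monomial m a =>
    simp only [Polynomial.eval_monomial]
    induction m generalizing b with
    | zero => simpa using IsTameMultiplier.const_mul_pow (E := E) (d := d) hα hr hb hb₁.le a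
    | succ m ih =>
      -- One contraction by `√b` for the factor `n`, another one for the remaining factors.
      have hs : 0 < √b := Real.sqrt_pos.mpr hb
      have hs₁ : √b < 1 := by rwa [Real.sqrt_lt' one_pos, one_pow]
      have h := (IsTameMultiplier.natCast_mul_pow (E := E) (d := d) hα hr hs hs₁).mul (ih hs hs₁)
      rw [Real.mul_self_sqrt hb.le] at h
      convert h using 2 with n
      have hb' : (b : ℂ) = (√b : ℂ) * (√b : ℂ) := by
        rw [← Complex.ofReal_mul, Real.mul_self_sqrt hb.le]
      rw [hb', mul_pow]
      ring

/-- Far enough to the right, all factors `1 / (n + N - z)` with `z` a root are tame. -/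
theorem exists_isTameMultiplier_inv_eval (P : Polynomial ℂ) :
    ∃ N₀ : ℕ, ∀ N : ℕ, N₀ ≤ N → ∀ d α r : ℝ, 0 < α → 0 < r →
      IsTameMultiplier E d α r 1 (fun n => (P.eval ((n + N : ℕ) : ℂ))⁻¹) := by
  have hprod : ∀ S : Multiset ℂ, ∃ N₀ : ℕ, ∀ N : ℕ, N₀ ≤ N → ∀ d α r : ℝ, 0 < α → 0 < r →
      IsTameMultiplier E d α r 1
        (fun n => ((S.map fun z => ((n + N : ℕ) : ℂ) - z).prod)⁻¹) := by
    intro S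
    induction S using Multiset.induction_on with
    | empty =>
      exact ⟨0, fun N _ d α r hα hr => by
        simpa using IsTameMultiplier.const (E := E) (d := d) hα hr 1⟩
    | cons z S ih =>
      obtain ⟨N₁, hN₁⟩ := ih
      obtain ⟨N₂, hN₂⟩ := exists_nat_gt (z.re + 1)
      refine ⟨max N₁ N₂, fun N hN d α r hα hr => ?_⟩
      have hμ : 1 < ((N : ℂ) - z).re := by
        have : (N₂ : ℝ) ≤ N := by exact_mod_cast (le_max_right _ _).trans hN
        simp only [Complex.sub_re, Complex.natCast_re]
        linarith
      have h := (IsTameMultiplier.inv_natCast_add (E := E) (d := d) hα hr hμ).mul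
        (hN₁ N ((le_max_left _ _).trans hN) d α r hα hr)
      rw [one_mul] at h
      convert h using 2 with n
      rw [Multiset.map_cons, Multiset.prod_cons, mul_inv]
      push_cast
      ring
  obtain ⟨N₀, hN₀⟩ := hprod P.roots
  refine ⟨N₀, fun N hN d α r hα hr => ?_⟩
  have h := (IsTameMultiplier.const (E := E) (d := d) hα hr P.leadingCoeff⁻¹).mul
    (hN₀ N hN d α r hα hr)
  rw [one_mul] at h
  convert h using 2 with n
  rw [(IsAlgClosed.splits P).eval_eq_prod_roots, mul_inv]

namespace PreservesExtendability

variable {k d : ℝ}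

theorem eval (hk : 0 < k) (P : Polynomial ℂ) :
    PreservesExtendability E k d (fun n => P.eval (n : ℂ)) := by
  have h₁ : PreservesExtendability E k d
      (fun n => P.eval (n : ℂ) * (((1 / 2 : ℝ) : ℂ)) ^ n) :=
    of_isTameMultiplier hk one_half_pos fun α r hα hr =>
      isTameMultiplier_eval_mul_pow hα hr one_half_pos one_half_lt_one P
  convert h₁.mul (pow (E := E) (k := k) (d := d) two_pos) using 2 with n
  rw [mul_assoc, ← mul_pow]
  norm_num

theorem inv_eval (hk : 0 < k) (P : Polynomial ℂ) :
    PreservesExtendability E k d (fun n => (P.eval (n : ℂ))⁻¹) := by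
  obtain ⟨N, hN⟩ := exists_isTameMultiplier_inv_eval (E := E) P
  exact of_shift hk N (of_isTameMultiplier hk one_pos (hN N le_rfl d))

end PreservesExtendability

end

theorem tendsto_eval_mul_pow_zero (P : Polynomial ℂ) {x : ℝ} (hx : 0 ≤ x) (hx₁ : x < 1) :
    Filter.Tendsto (fun n : ℕ => P.eval (n : ℂ) * (x : ℂ) ^ n) Filter.atTop (𝓝 0) := by
  induction P using Polynomial.induction_on' with
  | add P Q hP hQ => simpa only [Polynomial.eval_add, add_mul, add_zero] using hP.add hQ
  | monomial m a =>
    have h := (tendsto_pow_const_mul_const_pow_of_lt_one m hx hx₁).ofReal.const_mul a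
    simpa [mul_assoc] using h

theorem exists_norm_inv_eval_le (P : Polynomial ℂ) :
    ∃ M : ℝ, ∀ n : ℕ, ‖(P.eval (n : ℂ))⁻¹‖ ≤ M := by
  rcases lt_or_ge 0 P.degree with h | h
  · have h₁ := P.tendsto_norm_atTop h (z := fun n : ℕ => (n : ℂ)) (l := Filter.atTop)
      (by simpa using tendsto_natCast_atTop_atTop (R := ℝ))
    obtain ⟨M, hM⟩ := h₁.inv_tendsto_atTop.bddAbove_range
    exact ⟨M, fun n => by simpa using hM ⟨n, rfl⟩⟩
  · rw [Polynomial.eq_C_of_degree_le_zero h]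
    exact ⟨‖(P.coeff 0)⁻¹‖, fun n => by simp⟩

theorem eventually_norm_div_mul_pow_le {P Q : Polynomial ℂ} {b ϑ : ℝ} (hb : 0 ≤ b) (hbϑ : b < ϑ)
    {κ : ℝ} (hκ : 0 < κ) :
    ∀ᶠ n : ℕ in Filter.atTop,
      ‖P.eval (n : ℂ) * (Q.eval (n : ℂ))⁻¹ * (b : ℂ) ^ n‖ ≤ κ * ϑ ^ n := by
  have hϑ : 0 < ϑ := hb.trans_lt hbϑ
  obtain ⟨M, hM⟩ := exists_norm_inv_eval_le Q
  have hM0 : 0 ≤ M := (norm_nonneg _).trans (hM 0)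
  have h := (tendsto_eval_mul_pow_zero P (div_nonneg hb hϑ.le) ((div_lt_one hϑ).mpr hbϑ)).norm
  rw [norm_zero] at h
  filter_upwards [h.eventually (gt_mem_nhds (show 0 < κ / (M + 1) by positivity))] with n hn
  have hbn : (b : ℂ) ^ n = ((b / ϑ : ℝ) : ℂ) ^ n * (ϑ : ℂ) ^ n := by
    rw [← mul_pow, ← Complex.ofReal_mul, div_mul_cancel₀ _ hϑ.ne']
  rw [hbn]
  calc _ = ‖P.eval (n : ℂ) * ((b / ϑ : ℝ) : ℂ) ^ n‖ * ‖(Q.eval (n : ℂ))⁻¹‖ * ϑ ^ n := by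
        rw [norm_mul, norm_mul, norm_mul, norm_mul, norm_pow (ϑ : ℂ), Complex.norm_real,
          Real.norm_of_nonneg hϑ.le]
        ring
    _ ≤ κ / (M + 1) * (M + 1) * ϑ ^ n := by
        gcongr
        exact (hM n).trans (by linarith)
    _ = κ * ϑ ^ n := by rw [div_mul_cancel₀ _ (by positivity)]

/-! ### Sums of exponentials with rational coefficients -/

section

variable {E : Type u} [NormedAddCommGroup E] [NormedSpace ℂ E] [CompleteSpace E]

/-- If `ε` is a combination of terms `P(n) / Q(n) * bⁿ` with `b < 1`, then a shift of `ε` is both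
tame and small, so that `1 + ε` and its inverse preserve extendability. -/
theorem preservesExtendability_one_add_sum {ι : Type*} [Fintype ι] {k d : ℝ} (hk : 0 < k)
    (P Q : ι → Polynomial ℂ) {b : ι → ℝ} (hb : ∀ i, 0 < b i) (hb₁ : ∀ i, b i < 1) {ε : ℕ → ℂ}
    (hε : ∀ n : ℕ, ε n =
      ∑ i, (P i).eval (n : ℂ) * ((Q i).eval (n : ℂ))⁻¹ * (b i : ℂ) ^ n) :
    PreservesExtendability E k d (fun n => 1 + ε n) ∧
      PreservesExtendability E k d (fun n => (1 + ε n)⁻¹) := by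
  obtain ⟨ϑ, hϑb, hϑ, hϑ₁⟩ : ∃ ϑ : ℝ, (∀ i, b i < ϑ) ∧ 0 < ϑ ∧ ϑ < 1 := by
    have h₁ : ∀ᶠ x in 𝓝[<] (1 : ℝ), ∀ i, b i < x :=
      Filter.eventually_all.mpr fun i => nhdsWithin_le_nhds (lt_mem_nhds (hb₁ i))
    have h₂ : ∀ᶠ x in 𝓝[<] (1 : ℝ), 0 < x := nhdsWithin_le_nhds (lt_mem_nhds one_pos)
    obtain ⟨x, hx, hx0, hx₁⟩ := (h₁.and (h₂.and self_mem_nhdsWithin)).exists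
    exact ⟨x, hx, hx0, hx₁⟩
  have hsmall : ∀ᶠ n : ℕ in Filter.atTop, ‖ε n‖ ≤ ϑ ^ n := by
    have hκ : 0 < 1 / ((Fintype.card ι : ℝ) + 1) := by positivity
    have h₁ : ∀ᶠ n : ℕ in Filter.atTop, ∀ i,
        ‖(P i).eval (n : ℂ) * ((Q i).eval (n : ℂ))⁻¹ * (b i : ℂ) ^ n‖ ≤
          1 / ((Fintype.card ι : ℝ) + 1) * ϑ ^ n :=
      Filter.eventually_all.mpr fun i => eventually_norm_div_mul_pow_le (hb i).le (hϑb i) hκ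
    filter_upwards [h₁] with n hn
    rw [hε]
    refine (norm_sum_le_of_le _ fun i _ => hn i).trans ?_
    rw [Finset.sum_const, Finset.card_univ, nsmul_eq_mul, ← mul_assoc, mul_one_div]
    refine mul_le_of_le_one_left (by positivity) ?_
    rw [div_le_one (by positivity)]
    linarith
  have htame : ∀ᶠ N : ℕ in Filter.atTop, ∀ α r : ℝ, 0 < α → 0 < r →
      IsTameMultiplier E d α r ϑ (fun n => ε (n + N)) := by
    choose N₀ hN₀ using fun i => exists_isTameMultiplier_inv_eval (E := E) (Q i)
    filter_upwards [Filter.eventually_all.mpr fun i => Filter.eventually_ge_atTop (N₀ i)]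
      with N hN α r hα hr
    simp only [hε]
    refine IsTameMultiplier.sum hα hr hϑ hϑ₁.le fun i _ => ?_
    have h₁ := (((isTameMultiplier_eval_mul_pow (E := E) (d := d) hα hr (hb i) (hb₁ i)
      ((P i).comp (Polynomial.X + Polynomial.C (N : ℂ)))).mul
        (hN₀ i N (hN i) d α r hα hr)).mul
        (IsTameMultiplier.const hα hr ((b i : ℂ) ^ N)))
    rw [mul_one, mul_one] at h₁
    convert h₁.gain_mono (hb i) (hϑb i).le using 2 with n
    simp only [Polynomial.eval_comp, Polynomial.eval_add, Polynomial.eval_X, Polynomial.eval_C]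
    push_cast
    ring
  obtain ⟨N₁, hN₁⟩ := Filter.eventually_atTop.mp hsmall
  obtain ⟨N, hN, hNN₁, hN1⟩ := (htame.and ((Filter.eventually_ge_atTop N₁).and
    (Filter.eventually_ge_atTop 1))).exists
  constructor
  · refine PreservesExtendability.of_shift hk N
      (PreservesExtendability.of_isTameMultiplier hk one_pos fun α r hα hr => ?_)
    exact (IsTameMultiplier.const hα hr 1).add ((hN α r hα hr).gain_mono hϑ hϑ₁.le)
  · refine PreservesExtendability.of_shift hk N
      (PreservesExtendability.inv_one_add (ε := fun n => ε (n + N)) hk hϑ hϑ₁ hN fun n => ?_)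
    exact (hN₁ (n + N) (by omega)).trans (pow_le_pow_of_le_one hϑ.le hϑ₁.le (by omega))

end

theorem preservesSummability_of_preservesExtendability {m : ℕ → ℝ} (hm : ∀ n, m n ≠ 0)
    (h : ∀ (E : Type u) [NormedAddCommGroup E] [NormedSpace ℂ E] [CompleteSpace E] (k d : ℝ),
      0 < k → PreservesExtendability E k d (fun n => (m n : ℂ)) ∧
        PreservesExtendability E k d (fun n => ((m n : ℂ))⁻¹)) :
    PreservesSummability.{u} m := by
  intro E _ _ _ k hk d u
  obtain ⟨h₁, h₂⟩ := h E k d hk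
  constructor
  · intro hu
    have h₃ := h₂ _ hu
    have e : (fun n => ((m n : ℂ))⁻¹ • mBorel (gammaSeq k) u n) =
        mBorel (gammaSeq k) (mBorel m u) := by
      funext n
      exact smul_comm _ _ _
    rwa [e] at h₃
  · intro hu
    have h₃ := h₁ _ hu
    have e : (fun n => (m n : ℂ) • mBorel (gammaSeq k) (mBorel m u) n) =
        mBorel (gammaSeq k) u := by
      funext n
      unfold mBorel
      rw [smul_comm, smul_inv_smul₀ (Complex.ofReal_ne_zero.mpr (hm n))]
    rwa [e] at h₃

theorem mainTheorem10 (l : ℕ) (a : Fin (l + 1) → ℝ) (w v : Fin (l + 1) → Polynomial ℂ)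
    (m : ℕ → ℝ) (ha : ∀ i, 0 < a i) (ha_mono : StrictMono a)
    (hw : ∀ n : ℕ, (w (Fin.last l)).eval (n : ℂ) ≠ 0)
    (hv : ∀ i, ∀ n : ℕ, (v i).eval (n : ℂ) ≠ 0)
    (hm_pos : ∀ n, 0 < m n)
    (hm : ∀ n : ℕ, (m n : ℂ) =
      ∑ i, (w i).eval (n : ℂ) / (v i).eval (n : ℂ) * (a i : ℂ) ^ n) :
    PreservesSummability.{u} m := by
  refine preservesSummability_of_preservesExtendability (fun n => (hm_pos n).ne')
    fun E _ _ _ k d hk => ?_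
  have hL : 0 < a (Fin.last l) := ha _
  obtain ⟨ε, hε⟩ : ∃ ε : ℕ → ℂ, ∀ n : ℕ, ε n = ∑ i : Fin l,
      (w i.castSucc * v (Fin.last l)).eval (n : ℂ) *
        ((v i.castSucc * w (Fin.last l)).eval (n : ℂ))⁻¹ *
        ((a i.castSucc / a (Fin.last l) : ℝ) : ℂ) ^ n := ⟨_, fun _ => rfl⟩
  obtain ⟨h₁, h₂⟩ := preservesExtendability_one_add_sum (E := E) (d := d) hk _ _
    (fun i => div_pos (ha i.castSucc) hL)
    (fun i => (div_lt_one hL).mpr (ha_mono (Fin.castSucc_lt_last i))) hε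
  have hmε : ∀ n : ℕ, (m n : ℂ) = (w (Fin.last l)).eval (n : ℂ) *
      ((v (Fin.last l)).eval (n : ℂ))⁻¹ * (a (Fin.last l) : ℂ) ^ n * (1 + ε n) := by
    intro n
    have haL : (a (Fin.last l) : ℂ) ≠ 0 := Complex.ofReal_ne_zero.mpr hL.ne'
    have hwn := hw n
    have hvn := hv (Fin.last l) n
    rw [hm, hε, Fin.sum_univ_castSucc, mul_add, Finset.mul_sum, mul_one, add_comm,
      div_eq_mul_inv]
    congr 1
    refine Finset.sum_congr rfl fun i _ => ?_
    have hvi := hv i.castSucc n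
    rw [Polynomial.eval_mul, Polynomial.eval_mul]
    push_cast
    rw [div_pow]
    field_simp
  constructor
  · simp only [hmε]
    exact (((PreservesExtendability.eval hk _).mul (PreservesExtendability.inv_eval hk _)).mul
      (PreservesExtendability.pow hL)).mul h₁
  · have h₃ := (((PreservesExtendability.inv_eval (E := E) (d := d) hk (w (Fin.last l))).mul
      (PreservesExtendability.eval hk (v (Fin.last l)))).mul
      (PreservesExtendability.pow (inv_pos.mpr hL))).mul h₂
    convert h₃ using 2 with n
    rw [hmε, mul_inv, mul_inv, mul_inv, inv_inv, Complex.ofReal_inv, inv_pow]
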